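/- Let $X$ be a set and let $\mathbf d: X\times X\to[0,\infty]$ be a hemimetric, i.e. $\mathbf d(x,z)\le \mathbf d(x,y)+\mathbf d(y,z)$ and $\mathbf d(x,x)=0$ for all $x,y,z\in X$. **Definitions.** A *distance* on a set is a $[0,\infty]$-valued function $\mathbf e$ of two variables satisfying the triangle inequality; $\mathbf e^{\mathrm{op}}(x,y)=\mathbf e(y,x)$. A net $(x_\lambda)$ (indexed by a non-empty set with a transitive relation $\prec$ such that any two indices $\gamma,\delta$ have some $\lambda$ with $\gamma,\delta\prec\lambda$) is *$\mathbf e$-Cauchy* if $\lim_\gamma\sup_{\gamma\prec\delta}\mathbf e(x_\gamma,x_\delta)=0$; sequences are indexed by $(\mathbb N,<)$. The *Smyth topology* of $\mathbf e$ is generated by the sets $\{x:\mathbf e(c,x)<r\}$ and $\{x:\mathbf e(c,x)>r\}$. A set with a distance $\mathbf e$ is *Smyth complete* if every $\mathbf e$-Cauchy net has a limit in the Smyth topology. A subset $B$ is a *Smyth basis* if every point is a Smyth limit of an $\mathbf e$-Cauchy net in $B$. A *Smyth completion* of $(X,\mathbf d)$ is a set $X'\supseteq X$ with a distance $\mathbf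 d'$ extending $\mathbf d$ such that $(X',\mathbf d')$ is Smyth complete, $X$ is a Smyth basis of $X'$, and for all $x,z\in X'$ $$\sup_{y\in X'}(\mathbf d'(x,y)-\mathbf d'(z,y))_+\ \le\ \sup_{y\in X'}(\mathbf d'(y,z)-\mathbf d'(y,x))_+ ,$$ where $\infty-\infty=0$. It is a *hemimetric* Smyth completion if $\mathbf d'$ is a hemimetric. On $X_+=X\times[0,\infty)$ let $\mathbf d_+((x,r),(y,s))=(\mathbf d(x,y)-r+s)_+$. Let $\mathcal P_0^{\mathbf d}(X)$ be the collection of all $Y\subseteq X_+$ that are $\mathbf d_+$-directed, i.e. $\inf_{y\in Y}\sup_{z\in F}\mathbf d_+(z,y)=0$ for every finite $F\subseteq Y$ (with $\inf\emptyset=\infty$), and satisfy $\inf_{(x,r)\in Y}r=0$. For $Y,Z\subseteq X_+$ put $$\mathbf d_{+\mathcal H}(Y,Z)=\sup_{y\in Y}\inf_{z\in Z}\mathbf d_+(y,z),\qquad \mathbf d_+^{\mathcal H}(Y,Z)=\inf_{z\in Z}\sup_{y\in Y}\mathbf d_+(y,z).$$ **Theorem.** The following are equivalent. 1. $X$ is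 $\mathbf d$-Noetherian: every $\mathbf d$-Cauchy sequence in $X$ is $\mathbf d^{\mathrm{op}}$-Cauchy. 2. The Yoneda completion $(\mathcal P_0^{\mathbf d}(X),\mathbf d_{+\mathcal H})$ is Smyth complete. 3. $(\mathcal P_0^{\mathbf d}(X),\mathbf d_+^{\mathcal H})$ is a hemimetric space, i.e. $\mathbf d_+^{\mathcal H}$ is a hemimetric on $\mathcal P_0^{\mathbf d}(X)$. 4. $(X,\mathbf d)$ has a hemimetric Smyth completion. -/

import Mathlib

open scoped ENNReal NNReal

universe u

namespace DistDomain

/-! ### Generalised relations, distances and hemimetrics -/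

/-- A generalised relation between `X` and `Y`: a function `X × Y → [0, ∞]`. -/
abbrev GRel (X Y : Type u) : Type u := X → Y → ℝ≥0∞

/-- The opposite of a generalised relation on `X`. -/
def opp {X : Type u} (d : GRel X X) : GRel X X := fun x y => d y x

/-- The restriction of a generalised relation on `X` to a subset of `X`. -/
def restrict {X : Type u} (d : GRel X X) (S : Set X) : GRel S S := fun x y => d x y

/-- A distance satisfies the triangle inequality (and nothing else is required). -/
def IsDistance {X : Type u} (d : GRel X X) : Prop :=
  ∀ x y z : X, d x z ≤ d x y + d y z

/-- A hemimetric is a distance that vanishes on the diagonal. -/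
def IsHemimetric {X : Type u} (d : GRel X X) : Prop :=
  IsDistance d ∧ ∀ x : X, d x x = 0

/-- The upper hemimetric: `x, z ↦ sup_y (x d y - z d y)₊`.  Subtraction in `[0, ∞]` is truncated
at `0`, with `∞ - ∞ = 0`. -/
noncomputable def upperHemimetric {X : Type u} (d : GRel X X) : GRel X X :=
  fun x z => ⨆ y : X, (d x y - d z y)

/-- The lower hemimetric: `z, y ↦ sup_x (x d y - x d z)₊`. -/
noncomputable def lowerHemimetric {X : Type u} (d : GRel X X) : GRel X X :=
  fun z y => ⨆ x : X, (d x y - d x z)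

/-! ### Nets -/

/-- `prec` makes `Λ` a directed index set: it is non-empty, and `prec` is transitive (but
not necessarily reflexive) such that any two indices have a common strict successor. -/
structure IsNetOrder {Λ : Type u} (prec : Λ → Λ → Prop) : Prop where
  nonempty : Nonempty Λ
  trans : ∀ a b c : Λ, prec a b → prec b c → prec a c
  directed : ∀ a b : Λ, ∃ c : Λ, prec a c ∧ prec b c

/-- The filter on the index set generated by the tails `{δ | γ ≺ δ}`; limits along a net are limits
along this filter. -/
def tails {Λ : Type*} (prec : Λ → Λ → Prop) : Filter Λ :=
  ⨅ γ : Λ, Filter.principal {δ : Λ | prec γ δ}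

/-- `(x_γ)` is `d`-Cauchy: `lim_γ sup_{γ ≺ δ} x_γ d x_δ = 0`. -/
def IsCauchyNet {X : Type u} (d : GRel X X) {Λ : Type*} (prec : Λ → Λ → Prop) (x : Λ → X) :
    Prop :=
  Filter.Tendsto (fun γ : Λ => ⨆ (δ : Λ) (_ : prec γ δ), d (x γ) (x δ)) (tails prec) (nhds 0)

/-- A `d`-Cauchy sequence. -/
def IsCauchySequence {X : Type u} (d : GRel X X) (x : ℕ → X) : Prop :=
  IsCauchyNet d (fun m n : ℕ => m < n) x

/-- `X` is `d`-Noetherian if every `d`-Cauchy sequence is `d^op`-Cauchy. -/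
def IsNoetherian {X : Type u} (d : GRel X X) : Prop :=
  ∀ x : ℕ → X, IsCauchySequence d x → IsCauchySequence (opp d) x

/-! ### The Smyth topology, completeness, continuity, domains and completions -/

/-- The Smyth topology of `d`, generated by the upper balls `{x | c d x < r}` and the lower
holes `{x | c d x > r}`. -/
abbrev smythTopology {X : Type u} (d : GRel X X) : TopologicalSpace X :=
  TopologicalSpace.generateFrom
    ({U | ∃ (c : X) (r : ℝ≥0∞), U = {x | d c x < r}} ∪
      {U | ∃ (c : X) (r : ℝ≥0∞), U = {x | r < d c x}})

/-- The net `x` converges to `a` in the Smyth topology of `d`. -/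
def SmythConverges {X : Type u} (d : GRel X X) {Λ : Type*} (prec : Λ → Λ → Prop) (x : Λ → X)
    (a : X) : Prop :=
  Filter.Tendsto x (tails prec) (@nhds X (smythTopology d) a)

/-- `(X, d)` is Smyth complete: every `d`-Cauchy net has a limit in the Smyth topology. -/
def IsSmythComplete {X : Type u} (d : GRel X X) : Prop :=
  ∀ (Λ : Type u) (prec : Λ → Λ → Prop), IsNetOrder prec →
    ∀ x : Λ → X, IsCauchyNet d prec x → ∃ a : X, SmythConverges d prec x a

/-- `B` is a Smyth basis of `(X, d)`: every point of `X` is a limit, in the Smyth topology, of a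
`d`-Cauchy net in `B`. -/
def IsSmythBasis {X : Type u} (d : GRel X X) (B : Set X) : Prop :=
  ∀ a : X, ∃ (Λ : Type u) (prec : Λ → Λ → Prop) (x : Λ → X), IsNetOrder prec ∧
    (∀ γ : Λ, x γ ∈ B) ∧ IsCauchyNet d prec x ∧ SmythConverges d prec x a

/-- `(X, d)` is continuous with respect to the Smyth topology. -/
def IsSmythContinuous {X : Type u} (d : GRel X X) : Prop :=
  IsSmythBasis d Set.univ

/-- A predomain with respect to the Smyth topology. -/
def IsSmythPredomain {X : Type u} (d : GRel X X) : Prop :=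
  IsSmythContinuous d ∧ upperHemimetric d ≤ lowerHemimetric d

/-- A domain with respect to the Smyth topology. -/
def IsSmythDomain {X : Type u} (d : GRel X X) : Prop :=
  IsSmythComplete d ∧ IsSmythPredomain d

/-- `(X', d')` is a Smyth completion of `(X, d)` along the inclusion `i`: `d'` is a distance that
makes `X'` a domain with respect to the Smyth topology, `d'` extends `d`, and `X` is a
Smyth basis of `X'`. -/
structure IsSmythCompletion {X X' : Type u} (d : GRel X X) (d' : GRel X' X') (i : X → X') :
    Prop where
  isDistance : IsDistance d'
  isDomain : IsSmythDomain d'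
  injective : Function.Injective i
  extends_dist : ∀ x y : X, d' (i x) (i y) = d x y
  isBasis : IsSmythBasis d' (Set.range i)

/-- `(X, d)` has a Smyth completion whose distance is a hemimetric. -/
def HasHemimetricSmythCompletion {X : Type u} (d : GRel X X) : Prop :=
  ∃ (X' : Type u) (d' : GRel X' X') (i : X → X'), IsSmythCompletion d d' i ∧ IsHemimetric d'

/-! ### Directed subsets, Hausdorff distances and formal balls -/

/-- `Y` is `d`-directed: `inf_{y ∈ Y} sup_{z ∈ F} z d y = 0` for every finite `F ⊆ Y`
(where the infimum over the empty set is `∞`). -/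
def IsDirectedSet {X : Type u} (d : GRel X X) (Y : Set X) : Prop :=
  ∀ F : Set X, F.Finite → F ⊆ Y → (⨅ y ∈ Y, ⨆ z ∈ F, d z y) = 0

/-- The Hausdorff distance `Y, Z ↦ sup_{y ∈ Y} inf_{z ∈ Z} y d z`. -/
noncomputable def hausdorff {X : Type u} (d : GRel X X) : GRel (Set X) (Set X) :=
  fun Y Z => ⨆ y ∈ Y, ⨅ z ∈ Z, d y z

/-- The reverse Hausdorff distance `Y, Z ↦ inf_{z ∈ Z} sup_{y ∈ Y} y d z`. -/
noncomputable def revHausdorff {X : Type u} (d : GRel X X) : GRel (Set X) (Set X) :=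
  fun Y Z => ⨅ z ∈ Z, ⨆ y ∈ Y, d y z

/-- Formal balls: `X₊ = X × [0, ∞)`. -/
abbrev FormalBall (X : Type u) : Type u := X × ℝ≥0

/-- The distance `(x, r) d₊ (y, s) = (x d y - r + s)₊` on formal balls. -/
noncomputable def ballDist {X : Type u} (d : GRel X X) : GRel (FormalBall X) (FormalBall X) :=
  fun p q => (d p.1 q.1 + (q.2 : ℝ≥0∞)) - (p.2 : ℝ≥0∞)

/-- The aperture `inf_{(x, r) ∈ Y} r` of a set of formal balls. -/
noncomputable def aperture {X : Type u} (Y : Set (FormalBall X)) : ℝ≥0∞ :=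
  ⨅ p ∈ Y, (p.2 : ℝ≥0∞)

/-- The `d₊`-directed sets of formal balls with zero aperture. -/
def directedZero {X : Type u} (d : GRel X X) : Set (Set (FormalBall X)) :=
  {Y | IsDirectedSet (ballDist d) Y ∧ aperture Y = 0}

/-- The Hausdorff distance of `d₊` on the `d₊`-directed sets with zero aperture; this is the
Yoneda completion of `(X, d)`. -/
noncomputable def yonedaDist {X : Type u} (d : GRel X X) :
    GRel (directedZero d) (directedZero d) :=
  restrict (hausdorff (ballDist d)) (directedZero d)

/-- The reverse Hausdorff distance of `d₊` on the `d₊`-directed sets with zero aperture. -/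
noncomputable def revYonedaDist {X : Type u} (d : GRel X X) :
    GRel (directedZero d) (directedZero d) :=
  restrict (revHausdorff (ballDist d)) (directedZero d)

end DistDomain

/-! The pivot is the condition `revYonedaDist d Y Y = 0` for all `Y`, which is all that the third
statement adds to the triangle inequality. It says that each `Y` is approximated in both directions
by points of `X` (`exists_pointBall_approx`). A Cauchy net in the Yoneda completion always has a
limit as seen from points of `X`; under the pivot, points suffice to test Smyth convergence, so the
completion is Smyth complete with Smyth basis `X`, hence a hemimetric Smyth completion. Conversely,
if `X` embeds isometrically in a Smyth complete hemimetric space, a Cauchy sequence has a limit `a`,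
and testing convergence at `a` itself forces `d' a (x n) → 0`, which reverses the Cauchy condition.
Finally, if the pivot fails at `Y`, every ball of `Y` has another ball of `Y` uniformly far from it;
directedness yields a Cauchy sequence absorbing these far balls, which cannot be Cauchy backwards
(`revYonedaDist_self_of_isNoetherian`). -/

namespace DistDomain

variable {X X' : Type u}

open Filter Topology

/-! ### Nets -/

section Nets

variable {Λ : Type*} {prec : Λ → Λ → Prop}

theorem tails_hasBasis {Λ : Type u} {prec : Λ → Λ → Prop} (h : IsNetOrder prec) :
    (tails prec).HasBasis (fun _ => True) (fun γ => {δ | prec γ δ}) := by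
  have := h.nonempty
  refine hasBasis_iInf_principal ?_
  intro a b
  obtain ⟨c, hac, hbc⟩ := h.directed a b
  exact ⟨c, fun δ hδ => h.trans _ _ _ hac hδ, fun δ hδ => h.trans _ _ _ hbc hδ⟩

theorem tails_neBot {Λ : Type u} {prec : Λ → Λ → Prop} (h : IsNetOrder prec) :
    (tails prec).NeBot := by
  rw [(tails_hasBasis h).neBot_iff]
  intro γ _
  obtain ⟨c, hc, -⟩ := h.directed γ γ
  exact ⟨c, hc⟩

theorem tails_nat_lt : tails (fun m n : ℕ => m < n) = atTop := by
  refine le_antisymm ?_ ?_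
  · rw [atTop_basis_Ioi.ge_iff]
    intro n _
    exact mem_iInf_of_mem n (mem_principal_self _)
  · exact le_iInf fun n => le_principal_iff.2 (Ioi_mem_atTop n)

/-- Smyth completeness quantifies over index sets in `Type u`, so sequences enter it through `ULift
ℕ`. -/
theorem tails_ulift_nat_lt :
    tails (fun m n : ULift.{u} ℕ => m.down < n.down) = comap ULift.down atTop := by
  rw [← tails_nat_lt]
  simp only [tails, comap_iInf, comap_principal]
  exact Equiv.ulift.iInf_congr fun _ => rfl

theorem isNetOrder_ulift_nat_lt : IsNetOrder (fun m n : ULift.{u} ℕ => m.down < n.down) where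
  nonempty := ⟨⟨0⟩⟩
  trans _ _ _ := lt_trans
  directed a b := ⟨⟨max a.down b.down + 1⟩, by simp only; omega, by simp only; omega⟩

theorem isCauchyNet_iff_eventually {d : GRel X X} {x : Λ → X} :
    IsCauchyNet d prec x ↔
      ∀ ε : ℝ≥0∞, 0 < ε → ∀ᶠ γ in tails prec, ∀ δ, prec γ δ → d (x γ) (x δ) ≤ ε := by
  simp only [IsCauchyNet, ENNReal.tendsto_nhds_zero, iSup₂_le_iff, gt_iff_lt]

theorem isCauchySequence_iff {d : GRel X X} {x : ℕ → X} :
    IsCauchySequence d x ↔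
      ∀ ε : ℝ≥0∞, 0 < ε → ∃ N, ∀ m, N ≤ m → ∀ n, m < n → d (x m) (x n) ≤ ε := by
  simp only [IsCauchySequence, isCauchyNet_iff_eventually, tails_nat_lt, eventually_atTop]

theorem isCauchyNet_ulift {d : GRel X X} {x : ℕ → X} (h : IsCauchySequence d x) :
    IsCauchyNet d (fun m n : ULift.{u} ℕ => m.down < n.down) (fun n => x n.down) := by
  rw [isCauchyNet_iff_eventually, tails_ulift_nat_lt]
  rw [IsCauchySequence, isCauchyNet_iff_eventually, tails_nat_lt] at h
  intro ε hε
  exact ((h ε hε).comap _).mono fun γ hγ δ => hγ δ.down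

/-- The Smyth topology is the coarsest one making every `d c` continuous into `[0, ∞]`. -/
theorem smythConverges_iff {d : GRel X X} {x : Λ → X} {a : X} :
    SmythConverges d prec x a ↔
      ∀ c, Tendsto (fun γ => d c (x γ)) (tails prec) (𝓝 (d c a)) := by
  rw [SmythConverges, TopologicalSpace.tendsto_nhds_generateFrom_iff]
  constructor
  · intro h c
    rw [tendsto_order]
    exact ⟨fun r hr => h {y | r < d c y} (Or.inr ⟨c, r, rfl⟩) hr,
      fun r hr => h {y | d c y < r} (Or.inl ⟨c, r, rfl⟩) hr⟩
  · rintro h s (⟨c, r, rfl⟩ | ⟨c, r, rfl⟩) hs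
    · exact (tendsto_order.1 (h c)).2 r hs
    · exact (tendsto_order.1 (h c)).1 r hs

end Nets

/-- Limits survive uniform approximation; the bounds are additive so that infinite values are
allowed. -/
theorem tendsto_of_forall_approx {ι : Type*} {l : Filter ι} {g : ι → ℝ≥0∞} {G : ℝ≥0∞}
    (h : ∀ ε : ℝ≥0, 0 < ε → ∃ (f : ι → ℝ≥0∞) (F : ℝ≥0∞), Tendsto f l (𝓝 F) ∧
      (∀ᶠ i in l, g i ≤ f i + ε) ∧ (∀ᶠ i in l, f i ≤ g i + ε) ∧ F ≤ G + ε ∧ G ≤ F + ε) :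
    Tendsto g l (𝓝 G) := by
  have half : ∀ r : ℝ≥0, (r : ℝ≥0∞) = (r / 2 : ℝ≥0) + (r / 2 : ℝ≥0) := fun r => by
    rw [← ENNReal.coe_add, add_halves]
  rw [tendsto_order]
  refine ⟨fun a ha => ?_, fun a ha => ?_⟩
  · obtain ⟨r, hr, har⟩ := ENNReal.lt_iff_exists_add_pos_lt.1 ha
    obtain ⟨f, F, hf, -, hfg, -, hGF⟩ := h (r / 2) (half_pos hr)
    have h1 : a + (r / 2 : ℝ≥0) < F := by
      have := har.trans_le hGF
      rw [half r, ← add_assoc] at this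
      exact lt_of_add_lt_add_right this
    filter_upwards [(tendsto_order.1 hf).1 _ h1, hfg] with i hi hi'
    exact lt_of_add_lt_add_right (hi.trans_le hi')
  · obtain ⟨r, hr, har⟩ := ENNReal.lt_iff_exists_add_pos_lt.1 ha
    obtain ⟨f, F, hf, hgf, -, hFG, -⟩ := h (r / 2) (half_pos hr)
    have h1 : F + (r / 2 : ℝ≥0) < a := by
      refine lt_of_le_of_lt ?_ har
      rw [half r, ← add_assoc]
      gcongr
    have h2 : Tendsto (fun i => f i + (r / 2 : ℝ≥0)) l (𝓝 (F + (r / 2 : ℝ≥0))) :=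
      hf.add tendsto_const_nhds
    filter_upwards [(tendsto_order.1 h2).2 _ h1, hgf] with i hi hi'
    exact hi'.trans_lt hi

/-! ### Smyth completeness forces the Noetherian property -/

theorem isNoetherian_of_isometry_isSmythComplete {d : GRel X X} {d' : GRel X' X'}
    (hd' : IsHemimetric d') (hc : IsSmythComplete d') (i : X → X')
    (hi : ∀ x y, d' (i x) (i y) = d x y) : IsNoetherian d := by
  intro x hx
  have hix : IsCauchySequence d' (fun n => i (x n)) := by
    simpa only [isCauchySequence_iff, hi] using hx
  obtain ⟨a, ha⟩ := hc _ _ isNetOrder_ulift_nat_lt _ (isCauchyNet_ulift hix)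
  have hlim : ∀ c, Tendsto (fun n => d' c (i (x n))) atTop (𝓝 (d' c a)) := by
    intro c
    have h1 := smythConverges_iff.1 ha c
    rw [tails_ulift_nat_lt] at h1
    have h2 : Tendsto (ULift.up.{u} : ℕ → ULift.{u} ℕ) atTop (comap ULift.down atTop) :=
      tendsto_comap_iff.2 tendsto_id
    exact h1.comp h2
  rw [isCauchySequence_iff] at hx ⊢
  intro ε hε
  obtain ⟨N, hN⟩ := hx (ε / 2) (ENNReal.half_pos hε.ne')
  -- The zero diagonal of `d'` enters here: the limit is tested against itself.
  have h0 := hlim a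
  rw [hd'.2 a, ENNReal.tendsto_nhds_zero] at h0
  obtain ⟨M, hM⟩ := eventually_atTop.1 (h0 (ε / 2) (ENNReal.half_pos hε.ne'))
  refine ⟨max N M, fun m hm n hmn => ?_⟩
  have h1 : d' (i (x n)) a ≤ ε / 2 := by
    refine le_of_tendsto (hlim (i (x n))) ?_
    filter_upwards [eventually_gt_atTop n] with k hk
    rw [hi]
    exact hN n (by omega) k hk
  calc d (x n) (x m) = d' (i (x n)) (i (x m)) := (hi _ _).symm
    _ ≤ d' (i (x n)) a + d' a (i (x m)) := hd'.1 _ _ _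
    _ ≤ ε / 2 + ε / 2 := add_le_add h1 (hM m (by omega))
    _ = ε := ENNReal.add_halves ε

/-! ### Formal balls and Hausdorff distances -/

theorem IsDistance.ballDist {d : GRel X X} (hd : IsDistance d) : IsDistance (ballDist d) := by
  rintro ⟨x, r⟩ ⟨y, s⟩ ⟨z, t⟩
  simp only [DistDomain.ballDist, tsub_le_iff_right]
  calc d x z + t ≤ d x y + (d y z + t) := by
        rw [← add_assoc]; gcongr; exact hd _ _ _
    _ ≤ d x y + ((d y z + t - s) + s) := add_le_add le_rfl le_tsub_add
    _ = (d x y + s) + (d y z + t - s) := by ring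
    _ ≤ ((d x y + s - r) + r) + (d y z + t - s) := add_le_add le_tsub_add le_rfl
    _ = (d x y + s - r) + (d y z + t - s) + r := by ring

theorem hausdorff_le_revHausdorff (e : GRel X X) (Y Z : Set X) :
    hausdorff e Y Z ≤ revHausdorff e Y Z :=
  iSup₂_le fun y hy => le_iInf₂ fun z hz =>
    (iInf₂_le z hz).trans (le_iSup₂ (f := fun y (_ : y ∈ Y) => e y z) y hy)

theorem IsDistance.hausdorff {e : GRel X X} (he : IsDistance e) : IsDistance (hausdorff e) := by
  intro Y Z W
  refine iSup₂_le fun y hy => ?_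
  refine le_trans ?_ (add_le_add_left
    (le_iSup₂ (f := fun y (_ : y ∈ Y) => ⨅ z ∈ Z, e y z) y hy) _)
  rw [← tsub_le_iff_right]
  refine le_iInf₂ fun z hz => ?_
  rw [tsub_le_iff_right]
  refine le_trans ?_ (add_le_add_right
    (le_iSup₂ (f := fun z (_ : z ∈ Z) => ⨅ w ∈ W, e z w) z hz) _)
  rw [← tsub_le_iff_left]
  refine le_iInf₂ fun w hw => ?_
  rw [tsub_le_iff_left]
  exact (iInf₂_le w hw).trans (he _ _ _)

/-- A single `z` nearly optimal for `Y` is followed by a `w` close to `z`, so the second step only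
needs the smaller distance `hausdorff`. -/
theorem revHausdorff_le_add_hausdorff {e : GRel X X} (he : IsDistance e) (Y Z W : Set X) :
    revHausdorff e Y W ≤ revHausdorff e Y Z + hausdorff e Z W := by
  rw [← tsub_le_iff_right]
  refine le_iInf₂ fun z hz => ?_
  rw [tsub_le_iff_right]
  refine le_trans ?_ (add_le_add_right
    (le_iSup₂ (f := fun z (_ : z ∈ Z) => ⨅ w ∈ W, e z w) z hz) _)
  rw [← tsub_le_iff_left]
  refine le_iInf₂ fun w hw => ?_
  rw [tsub_le_iff_left]
  refine (iInf₂_le w hw).trans (iSup₂_le fun y hy => (he y z w).trans ?_)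
  gcongr
  exact le_iSup₂ (f := fun y (_ : y ∈ Y) => e y z) y hy

theorem IsDistance.revHausdorff {e : GRel X X} (he : IsDistance e) :
    IsDistance (revHausdorff e) := fun Y Z W =>
  (revHausdorff_le_add_hausdorff he Y Z W).trans
    (add_le_add_right (hausdorff_le_revHausdorff e Z W) _)

theorem IsDirectedSet.exists_forall_lt {e : GRel X X} {Y : Set X} (hY : IsDirectedSet e Y)
    {F : Set X} (hF : F.Finite) (hFY : F ⊆ Y) {ε : ℝ≥0∞} (hε : 0 < ε) :
    ∃ y ∈ Y, ∀ z ∈ F, e z y < ε := by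
  have h := hY F hF hFY
  rw [← h] at hε
  simp only [iInf_lt_iff] at hε
  obtain ⟨y, hy, hlt⟩ := hε
  exact ⟨y, hy, fun z hz =>
    (le_iSup₂ (f := fun z (_ : z ∈ F) => e z y) z hz).trans_lt hlt⟩

theorem isDirectedSet_of_forall_exists {e : GRel X X} {Y : Set X}
    (h : ∀ F : Set X, F.Finite → F ⊆ Y → ∀ ε : ℝ≥0, 0 < ε → ∃ y ∈ Y, ∀ z ∈ F, e z y ≤ ε) :
    IsDirectedSet e Y := by
  intro F hF hFY
  refine le_antisymm (ENNReal.le_of_forall_pos_le_add fun ε hε _ => ?_) bot_le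
  obtain ⟨y, hy, hyF⟩ := h F hF hFY ε hε
  rw [zero_add]
  exact (iInf₂_le y hy).trans (iSup₂_le hyF)

theorem radius_le_add_ballDist (d : GRel X X) (p q : FormalBall X) :
    (q.2 : ℝ≥0∞) ≤ p.2 + ballDist d p q :=
  le_trans le_add_self le_add_tsub

theorem dist_add_radius_le (d : GRel X X) (p q : FormalBall X) :
    d p.1 q.1 + q.2 ≤ p.2 + ballDist d p q :=
  le_add_tsub

theorem exists_radius_lt {d : GRel X X} {Y : Set (FormalBall X)} (hY : Y ∈ directedZero d)
    {ε : ℝ≥0∞} (hε : 0 < ε) : ∃ p ∈ Y, (p.2 : ℝ≥0∞) < ε := by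
  rw [← hY.2] at hε
  simpa only [aperture, iInf_lt_iff, exists_prop] using hε

theorem exists_mem_forall_ballDist_lt {d : GRel X X} {Y : Set (FormalBall X)}
    (hY : Y ∈ directedZero d) {F : Set (FormalBall X)} (hF : F.Finite) (hFY : F ⊆ Y)
    {ε : ℝ≥0∞} (hε : 0 < ε) :
    ∃ p ∈ Y, (p.2 : ℝ≥0∞) < ε ∧ ∀ q ∈ F, ballDist d q p < ε := by
  have hε' := ENNReal.half_pos hε.ne'
  -- Adding a ball of small radius to `F` forces the upper bound to have small radius too.
  obtain ⟨p, hp, hpε⟩ := exists_radius_lt hY hε'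
  obtain ⟨q, hq, hqF⟩ := hY.1.exists_forall_lt (hF.insert p)
    (Set.insert_subset hp hFY) hε'
  refine ⟨q, hq, ?_, fun z hz =>
    (hqF z (Set.mem_insert_of_mem _ hz)).trans_le ENNReal.half_le_self⟩
  calc (q.2 : ℝ≥0∞) ≤ p.2 + ballDist d p q := radius_le_add_ballDist d p q
    _ < ε / 2 + ε / 2 := ENNReal.add_lt_add hpε (hqF p (Set.mem_insert _ _))
    _ = ε := ENNReal.add_halves ε

theorem isHemimetric_yonedaDist {d : GRel X X} (hd : IsHemimetric d) :
    IsHemimetric (yonedaDist d) := by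
  refine ⟨fun Y Z W => hd.1.ballDist.hausdorff Y.1 Z.1 W.1, fun Y => ?_⟩
  refine le_antisymm (iSup₂_le fun y hy => ?_) bot_le
  simpa using (Y.2.1 {y} (Set.finite_singleton y) (Set.singleton_subset_iff.2 hy)).le

theorem isHemimetric_revYonedaDist_iff {d : GRel X X} (hd : IsHemimetric d) :
    IsHemimetric (revYonedaDist d) ↔ ∀ Y, revYonedaDist d Y Y = 0 :=
  ⟨fun h => h.2, fun h => ⟨fun Y Z W => hd.1.ballDist.revHausdorff Y.1 Z.1 W.1, h⟩⟩

/-! ### The embedding into the Yoneda completion -/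

/-- The point `x` as the directed set consisting of the formal ball `(x, 0)`. -/
def pointBall {d : GRel X X} (hd : IsHemimetric d) (x : X) : directedZero d :=
  ⟨{(x, 0)}, isDirectedSet_of_forall_exists fun F _ hF ε _ =>
      ⟨(x, 0), rfl, fun z hz => by
        rw [Set.mem_singleton_iff.1 (hF hz)]; simp [ballDist, hd.2]⟩,
    by simp [aperture]⟩

section Embedding

variable {d : GRel X X} (hd : IsHemimetric d)

theorem yonedaDist_pointBall_left (x : X) (Y : directedZero d) :
    yonedaDist d (pointBall hd x) Y = ⨅ p ∈ Y.1, (d x p.1 + p.2) := by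
  simp [yonedaDist, restrict, hausdorff, pointBall, ballDist]

theorem yonedaDist_pointBall_right (x : X) (Y : directedZero d) :
    yonedaDist d Y (pointBall hd x) = ⨆ p ∈ Y.1, (d p.1 x - p.2) := by
  simp [yonedaDist, restrict, hausdorff, pointBall, ballDist]

theorem yonedaDist_pointBall_pointBall (x y : X) :
    yonedaDist d (pointBall hd x) (pointBall hd y) = d x y := by
  simp [yonedaDist, restrict, hausdorff, pointBall, ballDist]

theorem pointBall_injective : Function.Injective (pointBall hd) := fun x y h => by
  simpa [pointBall] using congrArg Subtype.val h

theorem yonedaDist_pointBall_le_radius {Y : directedZero d} {p : FormalBall X} (hp : p ∈ Y.1) :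
    yonedaDist d (pointBall hd p.1) Y ≤ p.2 := by
  rw [yonedaDist_pointBall_left]
  exact (iInf₂_le p hp).trans (by rw [hd.2, zero_add])

/-- Some `z ∈ Y` nearly dominates all of `Y`, including balls of tiny radius, so its own radius is
small and its centre is the required point. -/
theorem exists_pointBall_approx {Y : directedZero d} (h : revYonedaDist d Y Y = 0)
    {ε : ℝ≥0∞} (hε : 0 < ε) : ∃ x, yonedaDist d Y (pointBall hd x) ≤ ε ∧
      yonedaDist d (pointBall hd x) Y ≤ ε := by
  have hε' := ENNReal.half_pos hε.ne'
  have hlt : revYonedaDist d Y Y < ε / 2 := h.trans_lt hε'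
  simp only [revYonedaDist, restrict, revHausdorff, iInf_lt_iff] at hlt
  obtain ⟨z, hz, hlt⟩ := hlt
  have hball : ∀ p ∈ Y.1, ballDist d p z ≤ ε / 2 := fun p hp =>
    (le_iSup₂ (f := fun p (_ : p ∈ Y.1) => ballDist d p z) p hp).trans hlt.le
  refine ⟨z.1, ?_, (yonedaDist_pointBall_le_radius hd hz).trans ?_⟩
  · rw [yonedaDist_pointBall_right]
    exact iSup₂_le fun p hp => (tsub_le_tsub_right le_self_add _).trans
      ((hball p hp).trans ENNReal.half_le_self)
  · obtain ⟨p, hp, hpε⟩ := exists_radius_lt Y.2 hε'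
    calc (z.2 : ℝ≥0∞) ≤ p.2 + ballDist d p z := radius_le_add_ballDist d p z
      _ ≤ ε / 2 + ε / 2 := add_le_add hpε.le (hball p hp)
      _ = ε := ENNReal.add_halves ε

end Embedding

/-! ### Noetherian spaces -/

theorem tendsto_inv_two_pow : Tendsto (fun n : ℕ => (2⁻¹ : ℝ≥0∞) ^ n) atTop (𝓝 0) :=
  ENNReal.tendsto_pow_atTop_nhds_zero_of_lt_one (ENNReal.inv_lt_one.2 ENNReal.one_lt_two)

/-- A sequence whose consecutive distances are dominated by a geometric sequence is Cauchy. -/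
theorem isCauchySequence_of_dist_succ_le {d : GRel X X} (hd : IsHemimetric d) {x : ℕ → X}
    {C : ℝ≥0∞} (hC : C ≠ ⊤) (h : ∀ n, d (x n) (x (n + 1)) ≤ C * 2⁻¹ ^ n) :
    IsCauchySequence d x := by
  have htwo : ∀ a : ℝ≥0∞, 2 * (a * 2⁻¹) = a := fun a => by
    rw [mul_left_comm, ENNReal.mul_inv_cancel two_ne_zero ENNReal.ofNat_ne_top, mul_one]
  have key : ∀ m k, d (x m) (x (m + k)) ≤ 2 * (C * 2⁻¹ ^ m) := by
    intro m k
    induction k generalizing m with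
    | zero => simp [hd.2]
    | succ k ih =>
      calc d (x m) (x (m + (k + 1)))
          ≤ d (x m) (x (m + 1)) + d (x (m + 1)) (x (m + 1 + k)) := by
            rw [show m + (k + 1) = m + 1 + k by ring]; exact hd.1 _ _ _
        _ ≤ C * 2⁻¹ ^ m + 2 * (C * 2⁻¹ ^ (m + 1)) := add_le_add (h m) (ih (m + 1))
        _ = 2 * (C * 2⁻¹ ^ m) := by rw [pow_succ, ← mul_assoc C, htwo, two_mul]
  have hlim : Tendsto (fun n : ℕ => 2 * (C * (2⁻¹ : ℝ≥0∞) ^ n)) atTop (𝓝 0) := by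
    simpa using ENNReal.Tendsto.const_mul
      (ENNReal.Tendsto.const_mul tendsto_inv_two_pow (Or.inr hC))
      (Or.inr (ENNReal.ofNat_ne_top (n := 2)))
  rw [isCauchySequence_iff]
  intro ε hε
  obtain ⟨N, hN⟩ := eventually_atTop.1 (ENNReal.tendsto_nhds_zero.1 hlim ε hε)
  refine ⟨N, fun m hm n hmn => ?_⟩
  obtain ⟨k, rfl⟩ := Nat.exists_eq_add_of_lt hmn
  exact (key m (k + 1)).trans (hN m hm)

theorem revYonedaDist_self_of_isNoetherian {d : GRel X X} (hd : IsHemimetric d)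
    (hN : IsNoetherian d) (Y : directedZero d) : revYonedaDist d Y Y = 0 := by
  by_contra hne
  obtain ⟨ε, hε, hlt⟩ := exists_between (pos_iff_ne_zero.2 hne)
  have hfar : ∀ z : Y.1, ∃ y : Y.1, ε < ballDist d y.1 z.1 := by
    by_contra! hcon
    obtain ⟨z, hz⟩ := hcon
    refine hlt.not_ge ((iInf₂_le z.1 z.2).trans (iSup₂_le fun y hy => hz ⟨y, hy⟩))
  choose far hfar using hfar
  have hstep : ∀ (n : ℕ) (z : Y.1), ∃ w : Y.1, (w.1.2 : ℝ≥0∞) < 2⁻¹ ^ n ∧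
      ballDist d z.1 w.1 < 2⁻¹ ^ n ∧ ballDist d (far z).1 w.1 < 2⁻¹ ^ n := by
    intro n z
    obtain ⟨w, hw, hwr, hwd⟩ := exists_mem_forall_ballDist_lt Y.2
      (Set.toFinite {z.1, (far z).1})
      (Set.insert_subset z.2 (Set.singleton_subset_iff.2 (far z).2))
      (ENNReal.pow_pos (ENNReal.inv_pos.2 (ENNReal.ofNat_ne_top (n := 2))) n)
    exact ⟨⟨w, hw⟩, hwr, hwd _ (by simp), hwd _ (by simp)⟩
  choose next hnr hnd hnf using hstep
  obtain ⟨p₀, hp₀, -⟩ := exists_radius_lt Y.2 zero_lt_one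
  let z : ℕ → Y.1 := fun n => Nat.rec ⟨p₀, hp₀⟩ (fun n w => next n w) n
  have hz : ∀ n, z (n + 1) = next n (z n) := fun n => rfl
  have hzr : ∀ n, ((z (n + 1)).1.2 : ℝ≥0∞) ≤ 2⁻¹ ^ n := fun n => by
    rw [hz]; exact (hnr n (z n)).le
  have hzd : ∀ n, ballDist d (z n).1 (z (n + 1)).1 ≤ 2⁻¹ ^ n := fun n => by
    rw [hz]; exact (hnd n (z n)).le
  have hanti : ∀ n : ℕ, (2⁻¹ : ℝ≥0∞) ^ (n + 1) ≤ 2⁻¹ ^ n := fun n => by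
    rw [pow_succ]
    exact mul_le_of_le_one_right' (ENNReal.inv_le_one.2 one_le_two)
  -- The shift drops `z 0`, whose radius `hzr` does not bound.
  have hcauchy : IsCauchySequence d (fun n => (z (n + 1)).1.1) := by
    refine isCauchySequence_of_dist_succ_le hd (ENNReal.ofNat_ne_top (n := 2)) fun n => ?_
    calc d (z (n + 1)).1.1 (z (n + 1 + 1)).1.1
        ≤ d (z (n + 1)).1.1 (z (n + 1 + 1)).1.1 + (z (n + 1 + 1)).1.2 := le_self_add
      _ ≤ (z (n + 1)).1.2 + ballDist d (z (n + 1)).1 (z (n + 1 + 1)).1 :=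
        dist_add_radius_le d _ _
      _ ≤ 2⁻¹ ^ n + 2⁻¹ ^ n := add_le_add (hzr n) ((hzd (n + 1)).trans (hanti n))
      _ = 2 * 2⁻¹ ^ n := (two_mul _).symm
  -- Three errors arise: far ball to `z (n + 2)`, the step back to `z (n + 1)`, and the radius of
  -- the latter.
  obtain ⟨N, hN⟩ := isCauchySequence_iff.1 (hN _ hcauchy) (ε / 4)
    (ENNReal.div_pos hε.ne' ENNReal.ofNat_ne_top)
  obtain ⟨M, hM⟩ := eventually_atTop.1 (ENNReal.tendsto_nhds_zero.1 tendsto_inv_two_pow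
    (ε / 4) (ENNReal.div_pos hε.ne' ENNReal.ofNat_ne_top))
  set n := max N M
  have hback : d (z (n + 2)).1.1 (z (n + 1)).1.1 ≤ ε / 4 :=
    hN n (le_max_left _ _) (n + 1) (Nat.lt_succ_self n)
  have hn : (2⁻¹ : ℝ≥0∞) ^ n ≤ ε / 4 := hM n (le_max_right _ _)
  refine (hfar (z (n + 1))).not_ge ?_
  calc ballDist d (far (z (n + 1))).1 (z (n + 1)).1
      ≤ ballDist d (far (z (n + 1))).1 (z (n + 2)).1
        + ballDist d (z (n + 2)).1 (z (n + 1)).1 := hd.1.ballDist _ _ _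
    _ ≤ ε / 4 + (ε / 4 + ε / 4) := by
      refine add_le_add ?_ (tsub_le_self.trans (add_le_add hback ((hzr n).trans hn)))
      exact (hnf (n + 1) (z (n + 1))).le.trans ((hanti n).trans hn)
    _ ≤ ε / 4 + (ε / 4 + ε / 4) + ε / 4 := le_self_add
    _ = 4 * (ε / 4) := by ring
    _ = ε := ENNReal.mul_div_cancel (by norm_num) ENNReal.ofNat_ne_top

/-! ### Completeness of the Yoneda completion -/

theorem exists_tendsto_of_isCauchyNet {e : GRel X X} (he : IsDistance e) {Λ : Type u}
    {prec : Λ → Λ → Prop} (hΛ : IsNetOrder prec) {x : Λ → X} (hx : IsCauchyNet e prec x) (c : X) :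
    ∃ r, Tendsto (fun γ => e c (x γ)) (tails prec) (𝓝 r) := by
  have := tails_neBot hΛ
  -- The values can increase by at most `ε` along a late tail, so the limsup exceeds the liminf by
  -- at most `ε`.
  refine ⟨_, tendsto_of_le_liminf_of_limsup_le le_rfl ?_⟩
  refine ENNReal.le_of_forall_pos_le_add fun ε hε _ => ?_
  have hev := isCauchyNet_iff_eventually.1 hx ε (by exact_mod_cast hε)
  rw [← tsub_le_iff_right]
  refine le_liminf_of_le (by isBoundedDefault) ?_
  filter_upwards [hev] with γ hγ
  rw [tsub_le_iff_right]
  refine limsup_le_of_le (by isBoundedDefault) ?_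
  filter_upwards [(tails_hasBasis hΛ).mem_of_mem (i := γ) trivial] with δ hδ
  exact (he _ _ _).trans (add_le_add le_rfl (hγ δ hδ))

/-- Every Cauchy net in the Yoneda completion has a limit as seen from the points of `X`. -/
theorem exists_forall_tendsto_pointBall {d : GRel X X} (hd : IsHemimetric d) {Λ : Type u}
    {prec : Λ → Λ → Prop} (hΛ : IsNetOrder prec) {Y : Λ → directedZero d}
    (hY : IsCauchyNet (yonedaDist d) prec Y) :
    ∃ Z : directedZero d, ∀ x, Tendsto (fun γ => yonedaDist d (pointBall hd x) (Y γ))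
      (tails prec) (𝓝 (yonedaDist d (pointBall hd x) Z)) := by
  have hD := isHemimetric_yonedaDist hd
  have := tails_neBot hΛ
  choose φ hφ using fun x => exists_tendsto_of_isCauchyNet hD.1 hΛ hY (pointBall hd x)
  have hφle : ∀ x y, φ x ≤ d x y + φ y := fun x y => by
    refine le_of_tendsto_of_tendsto' (hφ x) (tendsto_const_nhds.add (hφ y)) fun γ => ?_
    rw [← yonedaDist_pointBall_pointBall hd x y]
    exact hD.1 _ _ _
  -- The limit will be the strict epigraph of `φ`. Its finite subsets are bounded by passing to one
  -- late `Y γ` and using that `Y γ` is directed.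
  have key : ∀ F : Set (FormalBall X), F.Finite → (∀ p ∈ F, φ p.1 < p.2) → ∀ ε : ℝ≥0, 0 < ε →
      ∃ q : FormalBall X, φ q.1 < q.2 ∧ q.2 ≤ ε ∧ ∀ p ∈ F, ballDist d p q ≤ ε := by
    intro F hF hFφ ε hε
    have hε2 : (0 : ℝ≥0∞) < (ε / 2 : ℝ≥0) := by exact_mod_cast half_pos hε
    have hε4 : (0 : ℝ≥0∞) < (ε / 4 : ℝ≥0) := by
      exact_mod_cast div_pos hε (by norm_num)
    have hev : ∀ᶠ γ in tails prec, ∀ p ∈ F, yonedaDist d (pointBall hd p.1) (Y γ) < p.2 :=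
      (eventually_all_finite hF).2 fun p hp => (tendsto_order.1 (hφ p.1)).2 _ (hFφ p hp)
    obtain ⟨γ, hγ, hγF⟩ := ((isCauchyNet_iff_eventually.1 hY _ hε4).and hev).exists
    have hw : ∀ p ∈ F, ∃ w ∈ (Y γ).1, d p.1 w.1 + w.2 < p.2 := fun p hp => by
      have := hγF p hp
      simpa only [yonedaDist_pointBall_left, iInf_lt_iff, exists_prop] using this
    choose! w hwY hwd using hw
    obtain ⟨q, hq, hqr, hqd⟩ := exists_mem_forall_ballDist_lt (Y γ).2 (hF.image w)
      (by rintro _ ⟨p, hp, rfl⟩; exact hwY p hp) hε4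
    have hqr' : q.2 < ε / 4 := by exact_mod_cast hqr
    have hsum : (ε / 4 : ℝ≥0) + ε / 4 = ε / 2 := by
      rw [← add_div, ← two_mul]; field_simp; norm_num
    have hφq : φ q.1 ≤ q.2 + (ε / 4 : ℝ≥0) := by
      refine le_of_tendsto (hφ q.1) ?_
      filter_upwards [(tails_hasBasis hΛ).mem_of_mem (i := γ) trivial] with δ hδ
      exact (hD.1 _ _ _).trans
        (add_le_add (yonedaDist_pointBall_le_radius hd hq) (hγ δ hδ))
    have hφlt : φ q.1 < (ε / 2 : ℝ≥0) := by
      refine hφq.trans_lt ?_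
      rw [← hsum]
      exact_mod_cast add_lt_add_left hqr' (ε / 4)
    -- The radius of `q` is enlarged to `ε / 2` to exceed `φ q.1`, which is below `ε / 4` (radius)
    -- plus `ε / 4` (Cauchy error).
    refine ⟨(q.1, ε / 2), hφlt, half_le_self ε.2, fun p hp => ?_⟩
    have h1 : d (w p).1 q.1 ≤ (w p).2 + (ε / 4 : ℝ≥0) := le_self_add.trans
      ((dist_add_radius_le d (w p) q).trans
        (add_le_add le_rfl (hqd _ (Set.mem_image_of_mem w hp)).le))
    simp only [ballDist, tsub_le_iff_right]
    calc d p.1 q.1 + (ε / 2 : ℝ≥0)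
        ≤ d p.1 (w p).1 + ((w p).2 + (ε / 4 : ℝ≥0)) + (ε / 2 : ℝ≥0) := by
          gcongr; exact (hd.1 _ _ _).trans (add_le_add le_rfl h1)
      _ = (d p.1 (w p).1 + (w p).2) + ((ε / 4 : ℝ≥0) + (ε / 2 : ℝ≥0)) := by ring
      _ ≤ p.2 + (ε : ℝ≥0∞) := by
          refine add_le_add (hwd p hp).le ?_
          have : ε / 4 + ε / 2 ≤ ε := by
            rw [← NNReal.coe_le_coe]; push_cast; linarith [ε.2, ε.coe_nonneg]
          exact_mod_cast this
      _ = ε + p.2 := add_comm _ _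
  refine ⟨⟨{p | φ p.1 < p.2}, isDirectedSet_of_forall_exists fun F hF hFφ ε hε => ?_, ?_⟩,
    fun x => ?_⟩
  · obtain ⟨q, hq, -, hqF⟩ := key F hF hFφ ε hε
    exact ⟨q, hq, hqF⟩
  · refine le_antisymm (ENNReal.le_of_forall_pos_le_add fun ε hε _ => ?_) bot_le
    obtain ⟨q, hq, hqε, -⟩ := key ∅ Set.finite_empty (by simp) ε hε
    rw [zero_add]
    exact (iInf₂_le q hq).trans (by exact_mod_cast hqε)
  · convert hφ x using 2
    rw [yonedaDist_pointBall_left]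
    refine le_antisymm ?_ (le_iInf₂ fun p hp => ?_)
    · refine le_of_forall_gt_imp_ge_of_dense fun r hr => ?_
      obtain ⟨s, hs, hsr⟩ := ENNReal.lt_iff_exists_nnreal_btwn.1 hr
      refine (iInf₂_le (x, s) hs).trans ?_
      rw [hd.2, zero_add]
      exact hsr.le
    · exact (hφle x p.1).trans (add_le_add le_rfl (le_of_lt hp))

theorem isSmythComplete_yonedaDist {d : GRel X X} (hd : IsHemimetric d)
    (h : ∀ Y, revYonedaDist d Y Y = 0) : IsSmythComplete (yonedaDist d) := by
  intro Λ prec hΛ Y hY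
  have hD := isHemimetric_yonedaDist hd
  obtain ⟨Z, hZ⟩ := exists_forall_tendsto_pointBall hd hΛ hY
  refine ⟨Z, smythConverges_iff.2 fun C => tendsto_of_forall_approx fun ε hε => ?_⟩
  -- Replacing `C` by a nearby point changes distances out of it by at most `ε`, uniformly in the
  -- target.
  obtain ⟨x, hCx, hxC⟩ := exists_pointBall_approx hd (h C) (ENNReal.coe_pos.2 hε)
  have h1 : ∀ W, yonedaDist d C W ≤ yonedaDist d (pointBall hd x) W + ε := fun W =>
    (hD.1 _ (pointBall hd x) _).trans (by rw [add_comm]; exact add_le_add le_rfl hCx)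
  have h2 : ∀ W, yonedaDist d (pointBall hd x) W ≤ yonedaDist d C W + ε := fun W =>
    (hD.1 _ C _).trans (by rw [add_comm]; exact add_le_add le_rfl hxC)
  exact ⟨_, _, hZ x, Eventually.of_forall fun γ => h1 _, Eventually.of_forall fun γ => h2 _,
    h2 Z, h1 Z⟩

theorem isSmythBasis_range_pointBall {d : GRel X X} (hd : IsHemimetric d)
    (h : ∀ Y, revYonedaDist d Y Y = 0) :
    IsSmythBasis (yonedaDist d) (Set.range (pointBall hd)) := by
  intro Y
  have hD := isHemimetric_yonedaDist hd
  choose x hYx hxY using fun n : ℕ => exists_pointBall_approx hd (h Y)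
    (ENNReal.pow_pos (ENNReal.inv_pos.2 (ENNReal.ofNat_ne_top (n := 2))) n)
  have hsmall : ∀ ε : ℝ≥0∞, 0 < ε → ∃ N, ∀ n, N ≤ n →
      yonedaDist d Y (pointBall hd (x n)) ≤ ε ∧ yonedaDist d (pointBall hd (x n)) Y ≤ ε := by
    intro ε hε
    obtain ⟨N, hN⟩ := eventually_atTop.1
      (ENNReal.tendsto_nhds_zero.1 tendsto_inv_two_pow ε hε)
    exact ⟨N, fun n hn => ⟨(hYx n).trans (hN n hn), (hxY n).trans (hN n hn)⟩⟩
  refine ⟨ULift ℕ, _, fun n => pointBall hd (x n.down), isNetOrder_ulift_nat_lt,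
    fun n => ⟨_, rfl⟩, isCauchyNet_ulift (x := fun n => pointBall hd (x n)) ?_, ?_⟩
  · rw [isCauchySequence_iff]
    intro ε hε
    obtain ⟨N, hN⟩ := hsmall (ε / 2) (ENNReal.half_pos hε.ne')
    refine ⟨N, fun m hm n hmn => (hD.1 _ Y _).trans ?_⟩
    rw [← ENNReal.add_halves ε]
    exact add_le_add (hN m hm).2 (hN n (hm.trans hmn.le)).1
  · refine smythConverges_iff.2 fun C => ?_
    rw [tails_ulift_nat_lt]
    have hlim : Tendsto (fun n => yonedaDist d C (pointBall hd (x n))) atTop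
        (𝓝 (yonedaDist d C Y)) := by
      refine tendsto_of_forall_approx fun ε hε => ?_
      obtain ⟨N, hN⟩ := hsmall ε (ENNReal.coe_pos.2 hε)
      refine ⟨_, _, tendsto_const_nhds (x := yonedaDist d C Y), ?_, ?_, le_self_add, le_self_add⟩
      · filter_upwards [eventually_ge_atTop N] with n hn
        exact (hD.1 _ Y _).trans (add_le_add le_rfl (hN n hn).1)
      · filter_upwards [eventually_ge_atTop N] with n hn
        exact (hD.1 _ _ _).trans (add_le_add le_rfl (hN n hn).2)
    exact hlim.comp tendsto_comap

/-! ### Hemimetric Smyth completions -/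

/-- With a zero diagonal, constant nets give continuity and `d` itself lies between the upper and
lower hemimetrics. -/
theorem IsHemimetric.isSmythPredomain {d : GRel X X} (hd : IsHemimetric d) :
    IsSmythPredomain d := by
  refine ⟨fun a => ⟨PUnit, fun _ _ => True, fun _ => a,
    ⟨⟨⟨⟩⟩, fun _ _ _ _ _ => trivial, fun a _ => ⟨a, trivial, trivial⟩⟩,
    fun _ => trivial, ?_, ?_⟩, fun x z => ?_⟩
  · exact isCauchyNet_iff_eventually.2 fun ε _ =>
      Eventually.of_forall fun _ _ _ => (hd.2 a).le.trans bot_le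
  · exact smythConverges_iff.2 fun c => tendsto_const_nhds
  · calc upperHemimetric d x z ≤ d x z := iSup_le fun y => by
          rw [tsub_le_iff_right]; exact hd.1 _ _ _
      _ = d x z - d x x := by rw [hd.2, tsub_zero]
      _ ≤ lowerHemimetric d x z := le_iSup (fun y => d y z - d y x) x

theorem hasHemimetricSmythCompletion_of_revYonedaDist_self {d : GRel X X} (hd : IsHemimetric d)
    (h : ∀ Y, revYonedaDist d Y Y = 0) : HasHemimetricSmythCompletion d :=
  have hD := isHemimetric_yonedaDist hd
  ⟨directedZero d, yonedaDist d, pointBall hd,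
    { isDistance := hD.1
      isDomain := ⟨isSmythComplete_yonedaDist hd h, hD.isSmythPredomain⟩
      injective := pointBall_injective hd
      extends_dist := yonedaDist_pointBall_pointBall hd
      isBasis := isSmythBasis_range_pointBall hd h }, hD⟩

end DistDomain

theorem mainTheorem2 {X : Type u} (d : DistDomain.GRel X X) (hd : DistDomain.IsHemimetric d) :
    List.TFAE [
      DistDomain.IsNoetherian d,
      DistDomain.IsSmythComplete (DistDomain.yonedaDist d),
      DistDomain.IsHemimetric (DistDomain.revYonedaDist d),
      DistDomain.HasHemimetricSmythCompletion d] := by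
  tfae_have 1 → 3 := fun h => (DistDomain.isHemimetric_revYonedaDist_iff hd).2
    (DistDomain.revYonedaDist_self_of_isNoetherian hd h)
  tfae_have 3 → 2 := fun h => DistDomain.isSmythComplete_yonedaDist hd h.2
  tfae_have 2 → 1 := fun h => DistDomain.isNoetherian_of_isometry_isSmythComplete
    (DistDomain.isHemimetric_yonedaDist hd) h (DistDomain.pointBall hd)
    (DistDomain.yonedaDist_pointBall_pointBall hd)
  tfae_have 3 → 4 := fun h =>
    DistDomain.hasHemimetricSmythCompletion_of_revYonedaDist_self hd h.2
  tfae_have 4 → 1 := by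
    rintro ⟨X', d', i, hi, hd'⟩
    exact DistDomain.isNoetherian_of_isometry_isSmythComplete hd' hi.isDomain.1 i hi.extends_dist
  tfae_finish
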